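/- Let $k$ be an algebraically closed field of characteristic $0$, and let $n\ge 1$ and $N\ge 1$ be integers. Let $k(\underline z)$ be the purely transcendental extension of $k$ obtained by adjoining $n(N+1)$ variables $z_{ij}$ ($1\le i\le n$, $0\le j\le N$), and let $S=k(\underline z)[x_0,\dots,x_N]$. For $1\le i\le n$ let $P_i=[z_{i0}:z_{i1}:\dots:z_{iN}]\in\mathbb{P}^N_{k(\underline z)}$ be the $i$-th generic point, let $I(P_i)\subseteq S$ be its defining ideal (generated by the homogeneous polynomials that vanish at $P_i$), and let $H=\bigcap_{i=1}^n I(P_i)$. For a nonzero ideal $J\subseteq S$ let $\alpha(J)$ denote the least degree of a nonzero polynomial in $J$, and let $J^{(m)}=\bigcap_{p}\,(J^mS_p\cap S)$, where $p$ runs over the associated primes of $S/J$, be the $m$-th symbolic power of $J$. Then Chudnovsky's conjecture holds for $H$, that is, $$\frac{\alpha(H^{(m)})}{m}\ \ge\ \frac{\alpha(H)+N-1}{N}\qquad\text{for all } m\ge 1.$$ -/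

import Mathlib

open MvPolynomial
open scoped LinearAlgebra.Projectivization

noncomputable section

/-- The initial degree `α(I)` of an ideal of a polynomial ring: the least degree of a nonzero
polynomial in `I`. (For `I = 0`, where it is undefined, the value is `0`.) -/
def initialDegree {σ K : Type*} [Field K] (I : Ideal (MvPolynomial σ K)) : ℕ :=
  sInf {d : ℕ | ∃ f ∈ I, f ≠ 0 ∧ f.totalDegree = d}

/-- The `m`-th symbolic power `I^(m) = ⋂_p (I^m R_p ∩ R)`, where `p` runs over all associated
primes of `R/I`, and where `· ∩ R` is the contraction along `R → R_p`. -/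
def symbolicPower {R : Type*} [CommRing R] (I : Ideal R) (m : ℕ) : Ideal R :=
  ⨅ p : associatedPrimes R (R ⧸ I),
    ((I ^ m).map (algebraMap R (Localization.AtPrime p.1))).comap
      (algebraMap R (Localization.AtPrime p.1))

/-- The homogeneous ideal defining a point `P` of projective space `ℙ^N` over `K`: it is generated
by the homogeneous polynomials which vanish at `P` (that is, on the line in `K^(N+1)` that `P`
represents). -/
def pointIdeal {K : Type*} [Field K] {N : ℕ} (P : ℙ K (Fin (N + 1) → K)) :
    Ideal (MvPolynomial (Fin (N + 1)) K) :=
  Ideal.span {f | (∃ d : ℕ, f.IsHomogeneous d) ∧ ∀ v ∈ P.submodule, eval v f = 0}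

/-- The purely transcendental extension `k(z)` of `k` in `n(N+1)` variables `z_{ij}`. -/
abbrev GenericField (k : Type*) [Field k] (n N : ℕ) : Type _ :=
  FractionRing (MvPolynomial (Fin n × Fin (N + 1)) k)

/-- The coordinate vector `(z_{i0}, …, z_{iN})` over `k(z)`. -/
def genericCoords (k : Type*) [Field k] (n N : ℕ) (i : Fin n) :
    Fin (N + 1) → GenericField k n N :=
  fun j => algebraMap (MvPolynomial (Fin n × Fin (N + 1)) k) (GenericField k n N) (X (i, j))

theorem genericCoords_ne_zero (k : Type*) [Field k] (n N : ℕ) (i : Fin n) :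
    genericCoords k n N i ≠ 0 := by
  intro h
  have h0 : algebraMap (MvPolynomial (Fin n × Fin (N + 1)) k) (GenericField k n N)
      (X (i, 0)) = 0 := congrFun h 0
  exact X_ne_zero (R := k) (i, (0 : Fin (N + 1)))
    ((map_eq_zero_iff _ (IsFractionRing.injective _ _)).1 h0)

/-- The `i`-th generic point `P_i = [z_{i0} : … : z_{iN}]` of `ℙ^N` over `k(z)`. -/
def genericProjPoint (k : Type*) [Field k] (n N : ℕ) (i : Fin n) :
    ℙ (GenericField k n N) (Fin (N + 1) → GenericField k n N) :=
  Projectivization.mk _ (genericCoords k n N i) (genericCoords_ne_zero k n N i)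

/-- The defining ideal `H = ⋂ I(P_i)` of the `n` generic points. -/
def genericPointsIdeal (k : Type*) [Field k] (n N : ℕ) :
    Ideal (MvPolynomial (Fin (N + 1)) (GenericField k n N)) :=
  ⨅ i : Fin n, pointIdeal (genericProjPoint k n N i)

end

/-! Choose `d` with `(d+N).choose N ≤ n < (d+1+N).choose N`. Counting forms gives `α(H) ≤ d+1`, so
it suffices that a nonzero element of `H^(m)` has degree at least `m(d+N)/N`
(`mul_le_totalDegree_mul`).

By semicontinuity (`exists_specialization`), `(d+N).choose N` of the generic points may be moved to
the points of a star configuration without raising the degree. Take the hyperplanes `∑ (-1)^j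
a^(N-j) x_j = 0` for `a` in a set `A` of size `d+N`; those with parameters `q_1, …, q_N` meet at `[1
: e_1(q) : … : e_N(q)]`. Pulling back along the elementary symmetric polynomials in `y` gives a
polynomial of degree at most `deg g` in each `y_i`, vanishing to order `m` at the points of `A^N`
with distinct coordinates. `mul_card_le_of_le_vanishingOrder` then bounds `m` by induction on the
number of variables and the degree.

Vanishing at a projective point `z` is expressed as vanishing at the affine point `t z` over `K[t]`;
this handles inhomogeneous polynomials directly. -/

/-! ### Order of vanishing at an affine point -/

section VanishingOrder

variable {σ τ R S : Type*} [CommRing R] [CommRing S]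

/-- The ideal generated by the `X i - q i`. -/
noncomputable def affinePointIdeal (q : σ → R) : Ideal (MvPolynomial σ R) :=
  Ideal.span (Set.range fun i => X i - C (q i))

/-- The order of vanishing of a polynomial at a point of affine space. -/
noncomputable def vanishingOrder (q : σ → R) (f : MvPolynomial σ R) : ℕ∞ :=
  MvPowerSeries.order
    ((aeval (fun i => X i + C (q i)) f : MvPolynomial σ R) : MvPowerSeries σ R)

theorem X_sub_C_mem_affinePointIdeal (q : σ → R) (i : σ) :
    X i - C (q i) ∈ affinePointIdeal q :=
  Ideal.subset_span ⟨i, rfl⟩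

theorem sub_C_eval_mem_affinePointIdeal (q : σ → R) (f : MvPolynomial σ R) :
    f - C (eval q f) ∈ affinePointIdeal q := by
  rw [← Ideal.Quotient.eq]
  have h : (Ideal.Quotient.mkₐ R (affinePointIdeal q)) =
      (Ideal.Quotient.mkₐ R (affinePointIdeal q)).comp
        ((Algebra.ofId R (MvPolynomial σ R)).comp (aeval q)) := by
    apply MvPolynomial.algHom_ext
    intro i
    simp only [AlgHom.comp_apply, aeval_X, Ideal.Quotient.mkₐ_eq_mk]
    rw [Ideal.Quotient.eq]
    exact X_sub_C_mem_affinePointIdeal q i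
  exact DFunLike.congr_fun h f

theorem map_mem_affinePointIdeal_pow {q : σ → R} {q' : τ → S}
    (φ : MvPolynomial σ R →+* MvPolynomial τ S)
    (hφ : ∀ i, φ (X i - C (q i)) ∈ affinePointIdeal q') {m : ℕ} {f : MvPolynomial σ R}
    (hf : f ∈ affinePointIdeal q ^ m) : φ f ∈ affinePointIdeal q' ^ m := by
  have h1 : (affinePointIdeal q).map φ ≤ affinePointIdeal q' := by
    rw [affinePointIdeal, Ideal.map_span, Ideal.span_le]
    rintro _ ⟨_, ⟨i, rfl⟩, rfl⟩
    exact hφ i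
  have h2 := Ideal.mem_map_of_mem φ hf
  rw [Ideal.map_pow] at h2
  exact Ideal.pow_right_mono h1 m h2

theorem affinePointIdeal_zero : affinePointIdeal (0 : σ → R) = idealOfVars σ R := by
  simp [affinePointIdeal, idealOfVars]

theorem aeval_X_sub_C_aeval_X_add_C (q : σ → R) (f : MvPolynomial σ R) :
    aeval (fun i => X i - C (q i) : σ → MvPolynomial σ R) (aeval (fun i => X i + C (q i)) f) =
      f := by
  have h : (aeval (R := R) (fun i => X i - C (q i) : σ → MvPolynomial σ R)).comp
      (aeval (fun i => X i + C (q i))) = AlgHom.id R _ := by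
    apply MvPolynomial.algHom_ext
    intro i
    simp [algHom_C]
  exact DFunLike.congr_fun h f

/-- Translate `q` to the origin. The ideal side transports along ring homomorphisms, the order side
is additive on products over a domain; both are needed. -/
theorem le_vanishingOrder_iff {q : σ → R} {f : MvPolynomial σ R} {m : ℕ} :
    (m : ℕ∞) ≤ vanishingOrder q f ↔ f ∈ affinePointIdeal q ^ m := by
  have h0 : (m : ℕ∞) ≤ vanishingOrder q f ↔
      aeval (fun i => X i + C (q i)) f ∈ affinePointIdeal (0 : σ → R) ^ m := by
    rw [affinePointIdeal_zero, mem_pow_idealOfVars_iff']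
    constructor
    · intro h x hx
      have := MvPowerSeries.coeff_of_lt_order (f := ((aeval (fun i => X i + C (q i)) f :
        MvPolynomial σ R) : MvPowerSeries σ R)) (d := x)
        (lt_of_lt_of_le (by exact_mod_cast hx) h)
      simpa using this
    · intro h
      refine MvPowerSeries.nat_le_order fun d hd => ?_
      simpa using h d hd
  rw [h0]
  constructor
  · intro h
    have h1 := map_mem_affinePointIdeal_pow (q' := q)
      (aeval (R := R) (fun i => X i - C (q i) : σ → MvPolynomial σ R)).toRingHom
      (by intro i; simpa using X_sub_C_mem_affinePointIdeal q i) h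
    rw [← aeval_X_sub_C_aeval_X_add_C q f]
    exact h1
  · intro h
    refine map_mem_affinePointIdeal_pow
      (aeval (R := R) (fun i => X i + C (q i) : σ → MvPolynomial σ R)).toRingHom ?_ h
    intro i
    simpa [algHom_C] using X_sub_C_mem_affinePointIdeal (0 : σ → R) i

theorem le_vanishingOrder_map (φ : R →+* S) {q : σ → R} {f : MvPolynomial σ R} {m : ℕ}
    (h : (m : ℕ∞) ≤ vanishingOrder q f) :
    (m : ℕ∞) ≤ vanishingOrder (fun i => φ (q i)) (map φ f) := by
  rw [le_vanishingOrder_iff] at h ⊢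
  refine map_mem_affinePointIdeal_pow (map φ) (fun i => ?_) h
  simpa using X_sub_C_mem_affinePointIdeal (fun i => φ (q i)) i

theorem vanishingOrder_map_of_injective (φ : R →+* S) (hφ : Function.Injective φ) (q : σ → R)
    (f : MvPolynomial σ R) :
    vanishingOrder (fun i => φ (q i)) (map φ f) = vanishingOrder q f := by
  have h : aeval (fun i => X i + C (φ (q i)) : σ → MvPolynomial σ S) (map φ f) =
      map φ (aeval (fun i => X i + C (q i)) f) := by
    rw [aeval_eq_bind₁, aeval_eq_bind₁, map_bind₁]
    simp
  refine ENat.eq_of_forall_natCast_le_iff fun m => ?_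
  unfold vanishingOrder
  rw [h]
  constructor <;>
  · intro hm
    refine MvPowerSeries.nat_le_order fun d hd => ?_
    have := MvPowerSeries.coeff_of_lt_order (d := d)
        (lt_of_lt_of_le (by exact_mod_cast hd) hm)
    simpa [coeff_map, map_eq_zero_iff φ hφ] using this

theorem vanishingOrder_eq_zero {q : σ → R} {f : MvPolynomial σ R} (h : eval q f ≠ 0) :
    vanishingOrder q f = 0 := by
  by_contra hc
  have h1 : ((1 : ℕ) : ℕ∞) ≤ vanishingOrder q f := by
    simpa using Order.one_le_iff_ne_zero.2 hc
  rw [le_vanishingOrder_iff, pow_one] at h1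
  have h2 : affinePointIdeal q ≤ RingHom.ker (eval q) := by
    rw [affinePointIdeal, Ideal.span_le]
    rintro _ ⟨i, rfl⟩
    simp [RingHom.mem_ker]
  exact h (h2 h1)

variable [IsDomain R]

theorem vanishingOrder_mul (q : σ → R) (f g : MvPolynomial σ R) :
    vanishingOrder q (f * g) = vanishingOrder q f + vanishingOrder q g := by
  simp [vanishingOrder, MvPowerSeries.order_mul]

theorem vanishingOrder_prod {ι : Type*} (q : σ → R) (s : Finset ι) (f : ι → MvPolynomial σ R) :
    vanishingOrder q (∏ i ∈ s, f i) = ∑ i ∈ s, vanishingOrder q (f i) := by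
  classical
  induction s using Finset.induction_on with
  | empty => simpa using vanishingOrder_eq_zero (q := q) (f := 1) (by simp)
  | insert a s ha ih => rw [Finset.prod_insert ha, Finset.sum_insert ha, vanishingOrder_mul, ih]

open Classical in
theorem vanishingOrder_X_sub_C (q : σ → R) (i : σ) (a : R) :
    vanishingOrder q (X i - C a) = if q i = a then 1 else 0 := by
  split_ifs with h
  · subst h
    simp only [vanishingOrder, map_sub, aeval_X, algHom_C, algebraMap_eq, add_sub_cancel_right,
      coe_X, MvPowerSeries.X]
    rw [MvPowerSeries.order_monomial_of_ne_zero one_ne_zero]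
    simp
  · exact vanishingOrder_eq_zero (by simpa [sub_eq_zero] using h)

end VanishingOrder

/-! ### Degree bound for vanishing on a grid -/

section GridBound

variable {σ R : Type*} [CommRing R] [DecidableEq σ]

/-- Substituting the constant `a` for the `i`-th variable. -/
noncomputable def substConst (i : σ) (a : R) : MvPolynomial σ R →ₐ[R] MvPolynomial σ R :=
  aeval (Function.update X i (C a))

theorem X_sub_C_dvd_of_substConst_eq_zero {i : σ} {a : R} {f : MvPolynomial σ R}
    (h : substConst i a f = 0) : X i - C a ∣ f := by
  have h1 : (Ideal.Quotient.mkₐ R (Ideal.span {(X i - C a : MvPolynomial σ R)})) =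
      (Ideal.Quotient.mkₐ R (Ideal.span {(X i - C a : MvPolynomial σ R)})).comp
        (substConst i a) := by
    apply MvPolynomial.algHom_ext
    intro j
    simp only [AlgHom.comp_apply, substConst, aeval_X, Ideal.Quotient.mkₐ_eq_mk]
    rcases eq_or_ne j i with rfl | hj
    · rw [Function.update_self, Ideal.Quotient.eq]
      exact Ideal.mem_span_singleton_self _
    · rw [Function.update_of_ne hj]
  have h2 := DFunLike.congr_fun h1 f
  simp only [AlgHom.comp_apply, h, map_zero, Ideal.Quotient.mkₐ_eq_mk] at h2
  rwa [Ideal.Quotient.eq_zero_iff_mem, Ideal.mem_span_singleton] at h2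

theorem substConst_monomial (i : σ) (a : R) (s : σ →₀ ℕ) (c : R) :
    substConst i a (monomial s c) = monomial (s.erase i) (c * a ^ s i) := by
  have h1 : monomial s c = monomial (s.erase i) c * X i ^ s i := by
    rw [X_pow_eq_monomial, monomial_mul, mul_one, add_comm, Finsupp.single_add_erase]
  have h2 : substConst i a (monomial (s.erase i) c) = monomial (s.erase i) c := by
    rw [substConst, aeval_monomial, monomial_eq (s := s.erase i)]
    congr 1
    refine Finsupp.prod_congr fun j hj => ?_
    rw [Function.update_of_ne]
    rintro rfl
    simp at hj
  rw [h1, map_mul, map_pow, h2]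
  simp only [substConst, aeval_X, Function.update_self]
  rw [← C_pow, mul_comm, C_mul_monomial, mul_comm]

theorem degreeOf_substConst (i : σ) (a : R) (f : MvPolynomial σ R) (j : σ) :
    degreeOf j (substConst i a f) ≤ if j = i then 0 else degreeOf j f := by
  conv_lhs => rw [f.as_sum, map_sum]
  refine (degreeOf_sum_le _ _ _).trans (Finset.sup_le fun s hs => ?_)
  rw [substConst_monomial, degreeOf_le_iff]
  intro u hu
  have : u = s.erase i := by simpa using support_monomial_subset hu
  subst this
  split_ifs with h
  · simp [h]
  · rw [Finsupp.erase_ne h]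
    exact le_degreeOf_of_mem_support j hs

variable [IsDomain R]

theorem degreeOf_X_sub_C (i j : σ) (a : R) :
    degreeOf j (X i - C a : MvPolynomial σ R) = if i = j then 1 else 0 := by
  split_ifs with h
  · subst h
    rw [sub_eq_add_neg, ← C_neg, degreeOf_add_eq_of_degreeOf_lt] <;> simp
  · have := degreeOf_sub_le j (X i : MvPolynomial σ R) (C a)
    rw [degreeOf_X_of_ne (Ne.symm h), degreeOf_C] at this
    simpa using this

theorem X_sub_C_ne_zero_of_isDomain (i : σ) (a : R) : (X i - C a : MvPolynomial σ R) ≠ 0 :=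
  ne_zero_of_degreeOf_ne_zero (i := i) (by simp [degreeOf_X_sub_C])

/-- Substituting for one factor leaves every other factor nonzero, so the substitution must kill the
remaining cofactor. -/
theorem prod_X_sub_C_dvd {f : MvPolynomial σ R} (T : Finset (σ × R))
    (hf : ∀ p ∈ T, substConst p.1 p.2 f = 0) : ∏ p ∈ T, (X p.1 - C p.2) ∣ f := by
  classical
  induction T using Finset.induction_on with
  | empty => simp
  | insert p T hp ih =>
    obtain ⟨g, hg⟩ := ih fun p' hp' => hf p' (Finset.mem_insert_of_mem hp')
    have h1 := hf p (Finset.mem_insert_self _ _)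
    rw [hg, map_mul, map_prod, mul_eq_zero, Finset.prod_eq_zero_iff] at h1
    rcases h1 with ⟨p', hp', h2⟩ | h1
    · exfalso
      simp only [map_sub, substConst, aeval_X, algHom_C, algebraMap_eq] at h2
      rcases eq_or_ne p'.1 p.1 with h3 | h3
      · rw [h3, Function.update_self, ← C_sub, C_eq_zero, sub_eq_zero] at h2
        exact hp (by rwa [Prod.ext h3.symm h2])
      · rw [Function.update_of_ne h3] at h2
        exact X_sub_C_ne_zero_of_isDomain _ _ h2
    · obtain ⟨g', hg'⟩ := X_sub_C_dvd_of_substConst_eq_zero h1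
      exact ⟨g', by rw [Finset.prod_insert hp, hg, hg']; ring⟩

/-- A nonzero polynomial of degree at most `D` in each of the variables in `W` which vanishes to
order `m` at all points of the grid `A ^ W` with pairwise distinct coordinates satisfies
`m * #A ≤ D * #W`. -/
theorem mul_card_le_of_le_vanishingOrder (W : Finset σ) (A : Finset R) (hWA : W.card ≤ A.card)
    (D m : ℕ) (F : MvPolynomial σ R) (hF : F ≠ 0) (hdeg : ∀ i, degreeOf i F ≤ D)
    (hW : ∀ i ∉ W, degreeOf i F = 0)
    (hord : ∀ q : σ → R, Set.InjOn q W → Set.MapsTo q W A → (m : ℕ∞) ≤ vanishingOrder q F) :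
    m * A.card ≤ D * W.card ∧ m ≤ D := by
  classical
  induction hw : W.card generalizing W A D m F with
  | zero =>
    rw [Finset.card_eq_zero] at hw
    subst hw
    have h1 : F = C (coeff 0 F) := by
      rw [← totalDegree_eq_zero_iff_eq_C, totalDegree_eq_zero_iff]
      intro u hu i
      have := le_degreeOf_of_mem_support i hu
      rw [hW i (by simp)] at this
      omega
    have h2 := hord 0 (by simp) (by simp [Set.MapsTo])
    rw [vanishingOrder_eq_zero] at h2
    · have : m = 0 := by simpa using h2
      simp [this]
    · rw [h1] at hF ⊢
      simpa using hF
  | succ w ih =>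
    induction D using Nat.strong_induction_on generalizing m F with
    | _ D ihD =>
    -- If `F` vanishes on every grid hyperplane, divide by their product: this lowers `D` by `#A`
    -- and `m` by `#W`, which preserves the inequality.
    by_cases hsub : ∀ i ∈ W, ∀ a ∈ A, substConst i a F = 0
    · obtain ⟨G, hG⟩ := prod_X_sub_C_dvd (f := F) (W ×ˢ A) fun p hp =>
        hsub _ (Finset.mem_product.1 hp).1 _ (Finset.mem_product.1 hp).2
      set P : MvPolynomial σ R := ∏ p ∈ W ×ˢ A, (X p.1 - C p.2) with hP
      have hP0 : P ≠ 0 := fun h => hF (by rw [hG, h, zero_mul])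
      have hG0 : G ≠ 0 := fun h => hF (by rw [hG, h, mul_zero])
      have hPdeg : ∀ i, degreeOf i P = if i ∈ W then A.card else 0 := by
        intro i
        rw [hP, degreeOf_prod_eq _ _ fun p _ => X_sub_C_ne_zero_of_isDomain _ _, Finset.sum_product]
        simp [degreeOf_X_sub_C]
      have hdegF : ∀ i, degreeOf i F = (if i ∈ W then A.card else 0) + degreeOf i G := by
        intro i
        rw [hG, degreeOf_mul_eq hP0 hG0, hPdeg]
      obtain ⟨i, hi⟩ : W.Nonempty := Finset.card_pos.1 (by omega)
      have hAD : A.card ≤ D := by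
        have h1 := hdeg i
        have h2 := hdegF i
        rw [if_pos hi] at h2
        omega
      -- For each coordinate in `W` exactly one factor vanishes at `q`, to order one.
      have hPord : ∀ q : σ → R, Set.MapsTo q W A → vanishingOrder q P = (W.card : ℕ∞) := by
        intro q hq
        rw [hP, vanishingOrder_prod, Finset.sum_product]
        simp only [vanishingOrder_X_sub_C, Finset.sum_ite_eq]
        rw [Finset.sum_congr rfl fun j hj => if_pos (Finset.mem_coe.1 (hq hj))]
        simp
      have := ihD (D - A.card) (by omega) (m - W.card) G hG0 ?_ ?_ ?_
      · obtain ⟨h1, h2⟩ := this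
        rw [hw] at h1 h2 hWA
        obtain ⟨e, rfl⟩ := Nat.exists_eq_add_of_le hAD
        rw [Nat.add_sub_cancel_left] at h1 h2
        -- If `m ≤ #W` the subtraction truncates, and `#W ≤ #A ≤ D` suffices.
        rcases le_total m (w + 1) with h3 | h3
        · exact ⟨by nlinarith, by omega⟩
        · obtain ⟨l, rfl⟩ := Nat.exists_eq_add_of_le h3
          rw [Nat.add_sub_cancel_left] at h1 h2
          exact ⟨by nlinarith, by omega⟩
      · intro j
        have h1 := hdeg j
        have h2 := hdegF j
        by_cases hj : j ∈ W
        · rw [if_pos hj] at h2; omega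
        · have := hW j hj; omega
      · intro j hj
        have h1 := hW j hj
        have h2 := hdegF j
        omega
      · intro q hq1 hq2
        have h1 := hord q hq1 hq2
        rw [hG, vanishingOrder_mul, hPord q hq2] at h1
        rw [ENat.natCast_sub]
        exact tsub_le_iff_left.2 h1
    -- Otherwise restrict to a hyperplane on which `F` is nonzero. Removing `a` from `A` keeps
    -- coordinates distinct when `a` is put back in position `i`.
    · push Not at hsub
      obtain ⟨i, hi, a, ha, hne⟩ := hsub
      have hcard : (W.erase i).card = w := by rw [Finset.card_erase_of_mem hi]; omega
      have hcardA := Finset.card_erase_of_mem ha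
      have := ih (W.erase i) (A.erase a) (by omega) D m (substConst i a F) hne ?_ ?_ ?_ hcard
      · obtain ⟨h1, h2⟩ := this
        refine ⟨?_, h2⟩
        obtain ⟨s, hs⟩ : ∃ s, A.card = s + 1 := ⟨A.card - 1, by omega⟩
        rw [hcardA, hs, Nat.add_sub_cancel] at h1
        rw [hs]
        -- Add `m ≤ D` to `m * s ≤ D * w`; this is why the induction also carries `m ≤ D`.
        nlinarith
      · intro j
        refine (degreeOf_substConst i a F j).trans ?_
        split_ifs
        · exact Nat.zero_le _
        · exact hdeg j
      · intro j hj
        have h1 := degreeOf_substConst i a F j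
        split_ifs at h1 with hji
        · omega
        · have := hW j fun h => hj (Finset.mem_erase.2 ⟨hji, h⟩)
          omega
      · intro q hq1 hq2
        rw [le_vanishingOrder_iff]
        have hq' : ∀ j ∈ W, j ≠ i → q j ∈ A ∧ q j ≠ a := by
          intro j hj hji
          have := hq2 (Finset.mem_coe.2 (Finset.mem_erase.2 ⟨hji, hj⟩))
          rw [Finset.mem_coe, Finset.mem_erase] at this
          exact this.symm
        have h1 := hord (Function.update q i a) ?_ ?_
        · rw [le_vanishingOrder_iff] at h1
          refine map_mem_affinePointIdeal_pow (substConst i a).toRingHom ?_ h1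
          intro j
          rcases eq_or_ne j i with rfl | hj
          · simp [substConst]
          · simpa [substConst, Function.update_of_ne hj] using X_sub_C_mem_affinePointIdeal q j
        · intro j hj l hl hjl
          rcases eq_or_ne j i with rfl | hji <;> rcases eq_or_ne l j with rfl | hlj
          · rfl
          · rw [Function.update_self, Function.update_of_ne hlj] at hjl
            exact absurd hjl.symm (hq' l hl hlj).2
          · rfl
          · rw [Function.update_of_ne hji] at hjl
            rcases eq_or_ne l i with rfl | hli
            · rw [Function.update_self] at hjl
              exact absurd hjl (hq' j hj hji).2
            · rw [Function.update_of_ne hli] at hjl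
              exact hq1 (Finset.mem_coe.2 (Finset.mem_erase.2 ⟨hji, hj⟩))
                (Finset.mem_coe.2 (Finset.mem_erase.2 ⟨hli, hl⟩)) hjl
        · intro j hj
          rcases eq_or_ne j i with rfl | hji
          · simpa using ha
          · rw [Function.update_of_ne hji]
            exact (hq' j hj hji).1

end GridBound

/-! ### Star configurations and elementary symmetric polynomials -/

section SymmetricPullback

theorem totalDegree_map_le_totalDegree {σ R S : Type*} [CommRing R] [CommRing S] (φ : R →+* S)
    (f : MvPolynomial σ R) : (map φ f).totalDegree ≤ f.totalDegree :=
  Finset.sup_mono (support_map_subset φ f)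

theorem degreeOf_aeval_le_totalDegree {σ τ R : Type*} [CommRing R] (i : τ)
    (p : σ → MvPolynomial τ R) (hp : ∀ j, degreeOf i (p j) ≤ 1) (g : MvPolynomial σ R) :
    degreeOf i (aeval p g) ≤ g.totalDegree := by
  conv_lhs => rw [g.as_sum, map_sum]
  refine (degreeOf_sum_le _ _ _).trans (Finset.sup_le fun s hs => ?_)
  rw [aeval_monomial, algebraMap_eq]
  refine (degreeOf_C_mul_le _ _ _).trans (le_trans ?_ (le_totalDegree hs))
  rw [Finsupp.prod, Finsupp.sum]
  refine (degreeOf_prod_le _ _ _).trans (Finset.sum_le_sum fun j _ => ?_)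
  refine (degreeOf_pow_le _ _ _).trans ?_
  simpa using Nat.mul_le_mul_left (s j) (hp j)

theorem degreeOf_esymm_le_one {σ R : Type*} [Fintype σ] [CommRing R] [Nontrivial R] (i : σ)
    (l : ℕ) : degreeOf i (esymm σ R l) ≤ 1 := by
  classical
  rw [esymm]
  refine (degreeOf_sum_le _ _ _).trans (Finset.sup_le fun s _ => ?_)
  refine (degreeOf_prod_le _ _ _).trans ?_
  simp only [degreeOf_X]
  rw [Finset.sum_ite_eq]
  split_ifs <;> omega

/-- The point of the star configuration cut out by the hyperplanes with parameters `q i`. -/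
noncomputable def starPoint {K : Type*} [CommRing K] {N : ℕ} (q : Fin N → K) : Fin (N + 1) → K :=
  Fin.cons 1 fun j => eval q (esymm (Fin N) K (j + 1))

theorem starPoint_eq_of_range_eq {K : Type*} [CommRing K] {N : ℕ} {q q' : Fin N → K}
    (hq : Function.Injective q) (hq' : Function.Injective q')
    (h : Set.range q = Set.range q') : starPoint q = starPoint q' := by
  have h1 : Finset.univ.map ⟨q, hq⟩ = Finset.univ.map ⟨q', hq'⟩ := by
    apply Finset.coe_injective
    simpa using h
  have h2 : (Finset.univ : Finset (Fin N)).val.map q = Finset.univ.val.map q' :=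
    congrArg Finset.val h1
  unfold starPoint
  congr 1
  funext j
  have h3 : ∀ r : Fin N → K, eval r (esymm (Fin N) K (j + 1)) =
      (Finset.univ.val.map r).esymm (j + 1) := fun r => by
    rw [← aeval_esymm_eq_multiset_esymm (Fin N) K, aeval_eq_eval]
  rw [h3, h3, h2]

/-- The substitution `x₀ ↦ t`, `xⱼ ↦ t eⱼ(y)`. -/
noncomputable def symmetricPullback (K : Type*) [CommRing K] (N : ℕ) :
    MvPolynomial (Fin (N + 1)) (Polynomial K) →ₐ[Polynomial K]
      MvPolynomial (Fin N) (Polynomial K) :=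
  aeval (Fin.cons (C Polynomial.X)
    fun j : Fin N => C Polynomial.X * esymm (Fin N) (Polynomial K) (j + 1))

/-- Algebraic independence of the `e_j` reduces to `x₀ ↦ t`, `xⱼ ↦ t yⱼ`, whose values reach every
point with `x₀ ≠ 0`; hence `X 0 * g` would vanish everywhere. -/
theorem symmetricPullback_map_ne_zero {K : Type*} [Field K] [Infinite K] {N : ℕ}
    {g : MvPolynomial (Fin (N + 1)) K} (hg : g ≠ 0) :
    symmetricPullback K N (map Polynomial.C g) ≠ 0 := by
  intro h0
  let Ψ : MvPolynomial (Fin (N + 1)) (Polynomial K) →ₐ[Polynomial K]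
      MvPolynomial (Fin N) (Polynomial K) :=
    aeval (Fin.cons (C Polynomial.X) fun j : Fin N => C Polynomial.X * X j)
  have h1 : symmetricPullback K N =
      (aeval fun j : Fin N => esymm (Fin N) (Polynomial K) (j + 1)).comp Ψ := by
    apply MvPolynomial.algHom_ext
    intro j
    refine Fin.cases ?_ (fun j => ?_) j <;>
      simp [symmetricPullback, Ψ, algHom_C]
  have h2 : Ψ (map Polynomial.C g) = 0 := by
    apply esymmAlgHom_injective (σ := Fin N) (n := N) (Polynomial K) (by simp)
    rw [map_zero]
    apply Subtype.ext
    rw [esymmAlgHom_apply]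
    rw [h1] at h0
    exact h0
  have h3 : ∀ (a : K) (b : Fin N → K), eval (Fin.cons a fun j => a * b j) g = 0 := by
    intro a b
    have h4 : (Polynomial.evalRingHom a).comp ((eval fun j => Polynomial.C (b j)).comp
        ((Ψ : MvPolynomial (Fin (N + 1)) (Polynomial K) →+* _).comp (map Polynomial.C))) =
        eval (Fin.cons a fun j => a * b j) := by
      apply MvPolynomial.ringHom_ext
      · intro r
        simp [algHom_C]
      · intro j
        refine Fin.cases ?_ (fun j => ?_) j <;> simp [Ψ, mul_comm a]
    rw [← h4]
    simp [h2]
  have h5 : X 0 * g = 0 := by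
    apply MvPolynomial.funext
    intro v
    rw [map_mul, eval_X, map_zero, mul_eq_zero]
    by_cases hv : v 0 = 0
    · exact Or.inl hv
    · right
      convert h3 (v 0) fun j => v j.succ / v 0 using 2
      congr 1
      funext j
      refine Fin.cases ?_ (fun j => ?_) j
      · simp
      · simp [mul_div_cancel₀, hv]
  exact hg ((mul_eq_zero.1 h5).resolve_left (X_ne_zero _))

/-- A nonzero polynomial which vanishes to order `m` along the lines through the points of a star
configuration of `#A` hyperplanes has degree at least `m * #A / N`. -/
theorem mul_card_le_of_le_vanishingOrder_starPoint {K : Type*} [Field K] [Infinite K] {N : ℕ}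
    (A : Finset K) (hA : N ≤ A.card) {g : MvPolynomial (Fin (N + 1)) K} (hg : g ≠ 0) {m : ℕ}
    (h : ∀ q : Fin N → K, Function.Injective q → (∀ j, q j ∈ A) →
      (m : ℕ∞) ≤ vanishingOrder (fun j => Polynomial.X * Polynomial.C (starPoint q j))
        (map Polynomial.C g)) :
    m * A.card ≤ g.totalDegree * N := by
  classical
  have key := mul_card_le_of_le_vanishingOrder (Finset.univ : Finset (Fin N))
    (A.map ⟨Polynomial.C, Polynomial.C_injective⟩) (by simpa using hA) g.totalDegree m
    (symmetricPullback K N (map Polynomial.C g)) (symmetricPullback_map_ne_zero hg) ?_ (by simp) ?_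
  · simpa using key.1
  · intro i
    refine (degreeOf_aeval_le_totalDegree i _ ?_ _).trans ?_
    · intro j
      refine Fin.cases ?_ (fun j => ?_) j
      · simp
      · exact (degreeOf_C_mul_le _ _ _).trans (degreeOf_esymm_le_one _ _)
    · exact totalDegree_map_le_totalDegree _ _
  · intro q' hq' hq'A
    have h1 : ∀ j, ∃ a ∈ A, Polynomial.C a = q' j := by
      intro j
      simpa using hq'A (Finset.mem_coe.2 (Finset.mem_univ j))
    choose q hqA hq using h1
    have hinj : Function.Injective q := fun i j hij =>
      hq' (by simp) (by simp) (by rw [← hq, ← hq, hij])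
    have h2 := h q hinj hqA
    rw [le_vanishingOrder_iff] at h2 ⊢
    refine map_mem_affinePointIdeal_pow (symmetricPullback K N).toRingHom ?_ h2
    intro j
    refine Fin.cases ?_ (fun j => ?_) j
    · simp [symmetricPullback, starPoint, algHom_C]
    · have h3 := sub_C_eval_mem_affinePointIdeal q' (esymm (Fin N) (Polynomial K) (j + 1))
      have h4 : eval q' (esymm (Fin N) (Polynomial K) (j + 1)) =
          Polynomial.C (eval q (esymm (Fin N) K (j + 1))) := by
        rw [map_eval, map_esymm]
        congr 2
        exact (funext hq).symm
      rw [h4] at h3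
      have h5 := Ideal.mul_mem_left (affinePointIdeal q') (C Polynomial.X) h3
      have h6 : symmetricPullback K N
          (X j.succ - C (Polynomial.X * Polynomial.C (starPoint q j.succ))) =
          C Polynomial.X * (esymm (Fin N) (Polynomial K) (j + 1) -
            C (Polynomial.C (eval q (esymm (Fin N) K (j + 1))))) := by
        rw [map_sub, algHom_C, symmetricPullback, aeval_X, Fin.cons_succ, starPoint, Fin.cons_succ,
          algebraMap_eq, C_mul, mul_sub]
      rw [← h6] at h5
      exact h5

end SymmetricPullback

/-! ### Specialization of the generic points -/

section Specialization

theorem vanishingOrder_C_mul {σ R : Type*} [CommRing R] [IsDomain R] (q : σ → R) {a : R}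
    (ha : a ≠ 0) (f : MvPolynomial σ R) :
    vanishingOrder q (C a * f) = vanishingOrder q f := by
  rw [vanishingOrder_mul, vanishingOrder_eq_zero (by simpa using ha), zero_add]

theorem exists_eq_C_X_pow_mul {K κ : Type*} [Field K] {g : MvPolynomial κ (Polynomial K)}
    (hg : g ≠ 0) : ∃ (r : ℕ) (g' : MvPolynomial κ (Polynomial K)),
      g = C (Polynomial.X ^ r) * g' ∧ map (Polynomial.evalRingHom 0) g' ≠ 0 := by
  have h1 : ¬ IsUnit (C Polynomial.X : MvPolynomial κ (Polynomial K)) := by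
    intro h
    have := h.map (constantCoeff (σ := κ) (R := Polynomial K))
    simp [Polynomial.not_isUnit_X] at this
  obtain ⟨g', h2, h3⟩ :=
    (FiniteMultiplicity.of_not_isUnit h1 hg).exists_eq_pow_mul_and_not_dvd
  refine ⟨_, g', by rw [C_pow]; exact h2, fun h4 => h3 ?_⟩
  rw [C_dvd_iff_dvd_coeff]
  intro s
  have h5 := congrArg (coeff s) h4
  rw [coeff_map, coeff_zero] at h5
  rw [Polynomial.X_dvd_iff, Polynomial.coeff_zero_eq_eval_zero]
  exact h5

/-- Specialization at `0` of a family of polynomials over the affine line, after removing the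
fixed part. -/
theorem exists_specialization_zero {K κ : Type*} [Field K] {g : MvPolynomial κ (Polynomial K)}
    (hg : g ≠ 0) : ∃ g₀ : MvPolynomial κ K, g₀ ≠ 0 ∧ g₀.totalDegree ≤ g.totalDegree ∧
      ∀ (p : κ → Polynomial K) (m : ℕ),
        (m : ℕ∞) ≤ vanishingOrder (fun j => Polynomial.X * Polynomial.C (p j))
          (map Polynomial.C g) →
        (m : ℕ∞) ≤ vanishingOrder (fun j => Polynomial.X * Polynomial.C ((p j).eval 0))
          (map Polynomial.C g₀) := by
  obtain ⟨r, g', h1, h2⟩ := exists_eq_C_X_pow_mul hg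
  refine ⟨_, h2, ?_, fun p m h => ?_⟩
  · refine (totalDegree_map_le_totalDegree _ _).trans ?_
    rw [h1, totalDegree_mul_of_isDomain (by simp) (by rintro rfl; simp at h2)]
    omega
  -- The removed power of the parameter is a nonzero constant, so it has order zero.
  · rw [h1, map_mul, map_C, vanishingOrder_C_mul _ (by simp)] at h
    have h3 := le_vanishingOrder_map
      (Polynomial.mapRingHom (Polynomial.evalRingHom (0 : K))) h
    simpa [MvPolynomial.map_map, Polynomial.mapRingHom_comp_C] using h3

variable {k ι κ : Type*} [Field k]

theorem exists_C_mul_eq_map (A : Type*) {L : Type*} [CommRing A] [IsDomain A] [Field L]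
    [Algebra A L] [IsFractionRing A L] (f : MvPolynomial κ L) :
    ∃ (b : A) (f₀ : MvPolynomial κ A), b ≠ 0 ∧
      C (algebraMap A L b) * f = map (algebraMap A L) f₀ := by
  classical
  obtain ⟨⟨b, hb⟩, h⟩ := IsLocalization.exist_integer_multiples_of_finset (nonZeroDivisors A)
    (f.support.image fun s => coeff s f)
  have h' : ∀ s, ∃ r : A, algebraMap A L r =
      algebraMap A L b * coeff s f := by
    intro s
    by_cases hs : s ∈ f.support
    · obtain ⟨r, hr⟩ := h _ (Finset.mem_image_of_mem _ hs)
      exact ⟨r, by rw [hr, Algebra.smul_def]⟩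
    · exact ⟨0, by simp [notMem_support_iff.1 hs]⟩
  choose r hr using h'
  refine ⟨b, ∑ s ∈ f.support, monomial s (r s), nonZeroDivisors.ne_zero hb, ?_⟩
  conv_lhs => rw [f.as_sum]
  rw [Finset.mul_sum, map_sum]
  refine Finset.sum_congr rfl fun s _ => ?_
  rw [map_monomial, hr, C_mul_monomial]

/-- The substitution `z ↦ c + τ z`. -/
noncomputable def lineSubst {α : Type*} (c : α → k) :
    MvPolynomial α k →+* Polynomial (FractionRing (MvPolynomial α k)) :=
  eval₂Hom (Polynomial.C.comp (algebraMap k (FractionRing (MvPolynomial α k)))) fun a =>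
    Polynomial.X * Polynomial.C (algebraMap (MvPolynomial α k) _ (X a)) +
      Polynomial.C (algebraMap k _ (c a))

/-- At `τ = 1` the substitution is the invertible translation `z ↦ z + c`. -/
theorem lineSubst_injective {α : Type*} (c : α → k) : Function.Injective (lineSubst c) := by
  rw [injective_iff_map_eq_zero]
  intro f hf
  have h1 : (Polynomial.evalRingHom 1).comp (lineSubst c) =
      (algebraMap (MvPolynomial α k) (FractionRing (MvPolynomial α k))).comp
        (aeval (fun a => X a + C (c a)) : MvPolynomial α k →ₐ[k] MvPolynomial α k).toRingHom := by
    apply MvPolynomial.ringHom_ext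
    · intro r
      simp [lineSubst, algHom_C, IsScalarTower.algebraMap_apply k (MvPolynomial α k)
        (FractionRing (MvPolynomial α k))]
    · intro a
      simp [lineSubst, IsScalarTower.algebraMap_apply k (MvPolynomial α k)
        (FractionRing (MvPolynomial α k))]
  have h2 := DFunLike.congr_fun h1 f
  simp only [RingHom.comp_apply, hf, map_zero] at h2
  have h3 := (map_eq_zero_iff _ (IsFractionRing.injective (MvPolynomial α k)
    (FractionRing (MvPolynomial α k)))).1 h2.symm
  rw [← aeval_X_sub_C_aeval_X_add_C c f]
  erw [h3]
  simp

/-- Clear denominators to reach coefficients in `A`, apply `ψ` (injectivity keeps the polynomial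
nonzero), and specialize the resulting family at `0`. -/
theorem exists_specialization_of_injective {A L : Type*} [CommRing A] [IsDomain A] [Field L]
    [Algebra A L] [IsFractionRing A L] (ψ : A →+* Polynomial L) (hψ : Function.Injective ψ)
    {f : MvPolynomial κ L} (hf : f ≠ 0) :
    ∃ g : MvPolynomial κ L, g ≠ 0 ∧ g.totalDegree ≤ f.totalDegree ∧ ∀ (a : κ → A) (m : ℕ),
      (m : ℕ∞) ≤ vanishingOrder (fun j => Polynomial.X * Polynomial.C (algebraMap A L (a j)))
        (map Polynomial.C f) →
      (m : ℕ∞) ≤ vanishingOrder (fun j => Polynomial.X * Polynomial.C ((ψ (a j)).eval 0))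
        (map Polynomial.C g) := by
  have hinj : Function.Injective (algebraMap A L) := IsFractionRing.injective A L
  obtain ⟨b, f₀, hb, h1⟩ := exists_C_mul_eq_map A f
  have hb' : algebraMap A L b ≠ 0 := by rwa [Ne, map_eq_zero_iff _ hinj]
  have hf₀ : f₀ ≠ 0 := by
    rintro rfl
    rw [map_zero, mul_eq_zero, C_eq_zero] at h1
    exact h1.elim hb' hf
  have hdeg : f₀.totalDegree ≤ f.totalDegree := by
    refine Finset.sup_mono fun s hs => ?_
    rw [mem_support_iff] at hs ⊢
    intro h2
    have h3 := congrArg (coeff s) h1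
    rw [coeff_C_mul, h2, mul_zero, coeff_map] at h3
    exact hs ((map_eq_zero_iff _ hinj).1 h3.symm)
  obtain ⟨g, hg, hgdeg, hgord⟩ := exists_specialization_zero (g := map ψ f₀)
    ((map_ne_zero_iff _ (map_injective _ hψ)).2 hf₀)
  refine ⟨g, hg, hgdeg.trans ((totalDegree_map_le_totalDegree _ _).trans hdeg), fun a m h2 => ?_⟩
  have h3 : (m : ℕ∞) ≤ vanishingOrder (fun j => Polynomial.X * Polynomial.C (a j))
      (map Polynomial.C f₀) := by
    rw [← vanishingOrder_map_of_injective (Polynomial.mapRingHom (algebraMap A L))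
      (Polynomial.map_injective _ hinj)]
    rw [← vanishingOrder_C_mul _ (Polynomial.C_ne_zero.2 hb'), ← map_C, ← map_mul, h1] at h2
    simpa [MvPolynomial.map_map, Polynomial.mapRingHom_comp_C] using h2
  refine hgord (fun j => ψ (a j)) m ?_
  have h4 := le_vanishingOrder_map (Polynomial.mapRingHom ψ) h3
  simpa [MvPolynomial.map_map, Polynomial.mapRingHom_comp_C] using h4

/-- Semicontinuity: a polynomial over `k(z)` vanishing to prescribed orders along the lines through
generic points specializes to one vanishing to the same orders along the lines through given
points. -/
theorem exists_specialization (c : ι → κ → k)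
    {f : MvPolynomial κ (FractionRing (MvPolynomial (ι × κ) k))} (hf : f ≠ 0) :
    ∃ g : MvPolynomial κ (FractionRing (MvPolynomial (ι × κ) k)), g ≠ 0 ∧
      g.totalDegree ≤ f.totalDegree ∧ ∀ (i : ι) (m : ℕ),
        (m : ℕ∞) ≤ vanishingOrder (fun j => Polynomial.X * Polynomial.C
          (algebraMap (MvPolynomial (ι × κ) k) _ (X (i, j)))) (map Polynomial.C f) →
        (m : ℕ∞) ≤ vanishingOrder (fun j => Polynomial.X * Polynomial.C
          (algebraMap k (FractionRing (MvPolynomial (ι × κ) k)) (c i j))) (map Polynomial.C g) := by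
  obtain ⟨g, hg, hgdeg, hgord⟩ := exists_specialization_of_injective
    (lineSubst fun a : ι × κ => c a.1 a.2) (lineSubst_injective _) hf
  refine ⟨g, hg, hgdeg, fun i m h => ?_⟩
  have h1 := hgord (fun j => X (i, j)) m h
  simpa only [lineSubst, coe_eval₂Hom, eval₂_X, Polynomial.eval_add, Polynomial.eval_mul,
    Polynomial.eval_X, zero_mul, zero_add, Polynomial.eval_C] using h1

end Specialization

/-! ### Ideals of points and symbolic powers -/

section PointIdeal

variable {K : Type*} [Field K] {N : ℕ}

/-- Restriction of a polynomial to the line through the origin spanned by `z`. -/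
noncomputable def lineEval (z : Fin (N + 1) → K) :
    MvPolynomial (Fin (N + 1)) K →+* Polynomial K :=
  (eval fun j => Polynomial.X * Polynomial.C (z j)).comp (map Polynomial.C)

theorem lineEval_of_isHomogeneous (z : Fin (N + 1) → K) {f : MvPolynomial (Fin (N + 1)) K} {d : ℕ}
    (hf : f.IsHomogeneous d) : lineEval z f = Polynomial.X ^ d * Polynomial.C (eval z f) := by
  conv_lhs => rw [f.as_sum, map_sum]
  conv_rhs => rw [f.as_sum, map_sum, map_sum, Finset.mul_sum]
  refine Finset.sum_congr rfl fun s hs => ?_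
  have h1 : ∑ i, s i = d := by
    have := hf (mem_support_iff.1 hs)
    rw [← Finsupp.degree_eq_sum, Finsupp.degree_eq_weight_one]
    exact this
  simp only [lineEval, RingHom.comp_apply, map_monomial, eval_monomial]
  rw [Finsupp.prod_fintype _ _ fun _ => pow_zero _, Finsupp.prod_fintype _ _ fun _ => pow_zero _]
  simp only [mul_pow, Finset.prod_mul_distrib, Finset.prod_pow_eq_pow_sum, h1, map_mul, map_prod,
    map_pow]
  ring

/-- In `f(t z)` the homogeneous components contribute to distinct powers of `t`, so they vanish
separately. -/
theorem pointIdeal_mk (z : Fin (N + 1) → K) (hz : z ≠ 0) :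
    pointIdeal (Projectivization.mk K z hz) = RingHom.ker (lineEval z) := by
  apply le_antisymm
  · rw [pointIdeal, Ideal.span_le]
    rintro f ⟨⟨d, hd⟩, hf⟩
    have h1 : eval z f = 0 := hf z (by
      rw [Projectivization.submodule_mk]
      exact Submodule.mem_span_singleton_self z)
    rw [SetLike.mem_coe, RingHom.mem_ker, lineEval_of_isHomogeneous z hd, h1]
    simp
  · intro f hf
    rw [RingHom.mem_ker] at hf
    rw [← sum_homogeneousComponent f]
    have h1 : ∀ d ∈ Finset.range (f.totalDegree + 1), eval z (homogeneousComponent d f) = 0 := by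
      intro d hd
      have h2 := congrArg (fun p => Polynomial.coeff p d) hf
      simp only [Polynomial.coeff_zero] at h2
      rw [← sum_homogeneousComponent f, map_sum, Polynomial.finsetSum_coeff,
        Finset.sum_eq_single d] at h2
      · rwa [lineEval_of_isHomogeneous z (homogeneousComponent_isHomogeneous d f),
          Polynomial.coeff_X_pow_mul', if_pos le_rfl, Nat.sub_self, Polynomial.coeff_C_zero] at h2
      · intro e _ hed
        rw [lineEval_of_isHomogeneous z (homogeneousComponent_isHomogeneous e f),
          Polynomial.coeff_mul_C, Polynomial.coeff_X_pow, if_neg hed.symm, zero_mul]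
      · exact fun h => absurd hd h
    refine Ideal.sum_mem _ fun d hd => Ideal.subset_span
      ⟨⟨d, homogeneousComponent_isHomogeneous d f⟩, fun v hv => ?_⟩
    rw [Projectivization.submodule_mk, Submodule.mem_span_singleton] at hv
    obtain ⟨a, rfl⟩ := hv
    have h3 : eval (a • z) = (Polynomial.evalRingHom a).comp (lineEval z) := by
      apply MvPolynomial.ringHom_ext
      · intro r
        simp [lineEval]
      · intro j
        simp [lineEval, mul_comm a]
    rw [h3, RingHom.comp_apply,
      lineEval_of_isHomogeneous z (homogeneousComponent_isHomogeneous d f), h1 d hd]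
    simp

/-- A product lying in every `p j` with `j ≠ i` but not in `p i` has annihilator `p i` modulo the
intersection. -/
theorem mem_associatedPrimes_iInf {R ι : Type*} [CommRing R] [Finite ι] (p : ι → Ideal R)
    (hp : ∀ i, (p i).IsPrime) (hne : ∀ i j, j ≠ i → ¬ p j ≤ p i) (i : ι) :
    p i ∈ associatedPrimes R (R ⧸ ⨅ j, p j) := by
  classical
  cases nonempty_fintype ι
  have h1 : ∀ j, ∃ x, x ∉ p i ∧ (j ≠ i → x ∈ p j) := by
    intro j
    by_cases hj : j = i
    · exact ⟨1, (p i).ne_top_iff_one.1 (hp i).ne_top, fun h => absurd hj h⟩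
    · obtain ⟨x, hx, hx'⟩ := Set.not_subset.1 (hne i j hj)
      exact ⟨x, hx', fun _ => hx⟩
  choose x hx hx' using h1
  have h2 : ∏ j, x j ∉ p i := by
    rw [(hp i).prod_mem_iff]
    rintro ⟨j, _, hj⟩
    exact hx j hj
  refine ⟨hp i, Ideal.Quotient.mk _ (∏ j, x j), ?_⟩
  have h3 : Submodule.colon (⊥ : Submodule R (R ⧸ ⨅ j, p j))
      {Ideal.Quotient.mk (⨅ j, p j) (∏ j, x j)} = p i := by
    ext r
    rw [Submodule.mem_colon_singleton, Submodule.mem_bot, Algebra.smul_def,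
      Ideal.Quotient.algebraMap_eq, ← map_mul, Ideal.Quotient.eq_zero_iff_mem, Ideal.mem_iInf]
    constructor
    · intro h
      exact ((hp i).mem_or_mem (h i)).resolve_right h2
    · intro h j
      by_cases hj : j = i
      · subst hj
        exact Ideal.mul_mem_right _ _ h
      · exact Ideal.mul_mem_left _ _ (Ideal.mem_of_dvd _ (Finset.dvd_prod_of_mem x
          (Finset.mem_univ j)) (hx' j hj))
  rw [h3, (hp i).radical]

/-- Elements of the symbolic power of an intersection of ideals of points vanish to order `m` along
the lines defining the points. -/
theorem le_vanishingOrder_of_mem_symbolicPower {ι : Type*} [Finite ι]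
    (z : ι → Fin (N + 1) → K) (hz : ∀ i, z i ≠ 0)
    (hne : ∀ i j, j ≠ i → ¬ pointIdeal (Projectivization.mk K (z j) (hz j)) ≤
      pointIdeal (Projectivization.mk K (z i) (hz i))) {m : ℕ}
    {f : MvPolynomial (Fin (N + 1)) K}
    (hf : f ∈ symbolicPower (⨅ i, pointIdeal (Projectivization.mk K (z i) (hz i))) m) (i : ι) :
    (m : ℕ∞) ≤ vanishingOrder (fun j => Polynomial.X * Polynomial.C (z i j))
      (map Polynomial.C f) := by
  have hp : ∀ i, (pointIdeal (Projectivization.mk K (z i) (hz i))).IsPrime := fun i => by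
    rw [pointIdeal_mk]
    exact RingHom.ker_isPrime _
  have h1 := (Ideal.mem_iInf.1 hf) ⟨_, mem_associatedPrimes_iInf _ hp hne i⟩
  have := hp i
  rw [Ideal.mem_comap, IsLocalization.algebraMap_mem_map_algebraMap_iff
    (pointIdeal (Projectivization.mk K (z i) (hz i))).primeCompl] at h1
  -- Here `s * f` lies in the ordinary power and `s` does not vanish on the line, so `s` has order
  -- zero and `f` takes all of the order.
  obtain ⟨s, hs, h2⟩ := h1
  have h3 : ((⨅ i, pointIdeal (Projectivization.mk K (z i) (hz i))).map (map Polynomial.C)) ≤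
      affinePointIdeal (fun j => Polynomial.X * Polynomial.C (z i j)) := by
    refine (Ideal.map_mono (iInf_le _ i)).trans (Ideal.map_le_iff_le_comap.2 fun g hg => ?_)
    rw [pointIdeal_mk, RingHom.mem_ker] at hg
    have h4 := sub_C_eval_mem_affinePointIdeal
      (fun j => Polynomial.X * Polynomial.C (z i j)) (map Polynomial.C g)
    have h5 : eval (fun j => Polynomial.X * Polynomial.C (z i j)) (map Polynomial.C g) = 0 := hg
    rw [h5, map_zero, sub_zero] at h4
    exact h4
  have h6 := Ideal.mem_map_of_mem (map Polynomial.C) h2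
  rw [Ideal.map_pow, map_mul] at h6
  have h7 := le_vanishingOrder_iff.2 (Ideal.pow_right_mono h3 m h6)
  rw [vanishingOrder_mul, vanishingOrder_eq_zero, zero_add] at h7
  · exact h7
  · intro h8
    apply hs
    rw [SetLike.mem_coe, pointIdeal_mk, RingHom.mem_ker]
    exact h8

/-- There are more monomials of degree `d` than linear conditions. -/
theorem exists_isHomogeneous_mem_iInf_pointIdeal {ι : Type*} [Fintype ι]
    (z : ι → Fin (N + 1) → K) (hz : ∀ i, z i ≠ 0) (d : ℕ)
    (hd : Fintype.card ι < (d + N).choose N) :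
    ∃ f ∈ ⨅ i, pointIdeal (Projectivization.mk K (z i) (hz i)),
      f ≠ 0 ∧ f.totalDegree = d := by
  classical
  let B := (Finset.univ : Finset (Fin (N + 1))).finsuppAntidiag d
  let φ : (B → K) →ₗ[K] MvPolynomial (Fin (N + 1)) K :=
    Fintype.linearCombination K fun s : B => (monomial s.1 1 : MvPolynomial (Fin (N + 1)) K)
  have hφ : Function.Injective φ := by
    rw [← linearIndependent_iff_injective_fintypeLinearCombination]
    have := (basisMonomials (Fin (N + 1)) K).linearIndependent.comp (Subtype.val : B → _)
      Subtype.val_injective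
    simpa [Function.comp_def] using this
  let ψ : (B → K) →ₗ[K] (ι → K) := (LinearMap.pi fun i => (aeval (z i)).toLinearMap) ∘ₗ φ
  have hψ : LinearMap.ker ψ ≠ ⊥ := by
    apply LinearMap.ker_ne_bot_of_finrank_lt
    have hB : B.card = (d + N).choose N := by
      rw [Finset.card_finsuppAntidiag_nat_eq_choose, Finset.card_univ, Fintype.card_fin,
        ← Nat.choose_symm_add]
      congr 1
      omega
    simpa [hB] using hd
  obtain ⟨v, hv, hv0⟩ := Submodule.exists_mem_ne_zero_of_ne_bot hψ
  have hhom : (φ v).IsHomogeneous d := by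
    rw [← mem_homogeneousSubmodule]
    simp only [φ, Fintype.linearCombination_apply]
    refine Submodule.sum_mem _ fun s _ => Submodule.smul_mem _ _ ?_
    rw [mem_homogeneousSubmodule]
    apply isHomogeneous_monomial
    rw [Finsupp.degree_eq_sum]
    exact (Finset.mem_finsuppAntidiag.1 s.2).1
  have hne : φ v ≠ 0 := (map_ne_zero_iff φ hφ).2 hv0
  refine ⟨φ v, Ideal.mem_iInf.2 fun i => ?_, hne, hhom.totalDegree hne⟩
  have h1 : eval (z i) (φ v) = 0 := congrFun (LinearMap.mem_ker.1 hv) i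
  rw [pointIdeal_mk, RingHom.mem_ker, lineEval_of_isHomogeneous _ hhom, h1]
  simp

theorem lt_choose_add {N : ℕ} (hN : 1 ≤ N) (n : ℕ) : n < (n + N).choose N := by
  obtain ⟨M, rfl⟩ := Nat.exists_eq_add_of_le' hN
  induction n with
  | zero => simp
  | succ n ih =>
    have h1 : 0 < (n + (M + 1)).choose M := Nat.choose_pos (by omega)
    have h2 : n + 1 + (M + 1) = n + (M + 1) + 1 := by ring
    rw [h2, Nat.choose_succ_succ']
    omega

/-- The linear form `z_{j0} x_1 - z_{j1} x_0` vanishes at `P_j` but not at `P_i`. -/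
theorem not_pointIdeal_genericProjPoint_le (k : Type*) [Field k] {n N : ℕ} (hN : 1 ≤ N)
    (i j : Fin n) (hij : j ≠ i) :
    ¬ pointIdeal (genericProjPoint k n N j) ≤ pointIdeal (genericProjPoint k n N i) := by
  intro h
  obtain ⟨M, rfl⟩ := Nat.exists_eq_add_of_le' hN
  let A := MvPolynomial (Fin n × Fin (M + 1 + 1)) k
  let z := genericCoords k n (M + 1)
  let f : MvPolynomial (Fin (M + 1 + 1)) (GenericField k n (M + 1)) :=
    C (z j 0) * X 1 - C (z j 1) * X 0
  have hf : f.IsHomogeneous 1 :=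
    ((isHomogeneous_X _ 1).C_mul _).sub ((isHomogeneous_X _ 0).C_mul _)
  have key : ∀ l, f ∈ pointIdeal (genericProjPoint k n (M + 1) l) ↔
      z j 0 * z l 1 - z j 1 * z l 0 = 0 := by
    intro l
    rw [genericProjPoint, pointIdeal_mk, RingHom.mem_ker, lineEval_of_isHomogeneous _ hf]
    have h0 : eval (genericCoords k n (M + 1) l) f = z j 0 * z l 1 - z j 1 * z l 0 := by
      simp [f, z]
    rw [h0, pow_one, mul_eq_zero, or_iff_right Polynomial.X_ne_zero, Polynomial.C_eq_zero]
  have h1 := (key i).1 (h ((key j).2 (by ring)))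
  have h2 : (X (j, 0) * X (i, 1) - X (j, 1) * X (i, 0) : A) = 0 := by
    apply IsFractionRing.injective A (FractionRing A)
    rw [map_sub, map_mul, map_mul, map_zero]
    exact h1
  classical
  have h3 := congrArg (eval fun a : Fin n × Fin (M + 1 + 1) =>
    if a = (j, 0) ∨ a = (i, 1) then (1 : k) else 0) h2
  simp [hij, hij.symm] at h3

end PointIdeal

/-! ### Assembling the bound -/

section Main

theorem mul_le_totalDegree_mul {k : Type*} [Field k] [Infinite k] {n N d m : ℕ}
    (hN : 1 ≤ N) (hd : (d + N).choose N ≤ n)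
    {f : MvPolynomial (Fin (N + 1)) (GenericField k n N)} (hf0 : f ≠ 0)
    (hf : f ∈ symbolicPower (genericPointsIdeal k n N) m) :
    m * (d + N) ≤ f.totalDegree * N := by
  classical
  obtain ⟨A, hA⟩ := Infinite.exists_subset_card_eq k (d + N)
  have hcard : Fintype.card (A.powersetCard N) ≤ Fintype.card (Fin n) := by
    simpa [hA] using hd
  obtain ⟨e⟩ := Function.Embedding.nonempty_of_card_le hcard
  let pt : A.powersetCard N → Fin (N + 1) → k := fun S => starPoint fun j =>
    ((S.1.equivFinOfCardEq (Finset.mem_powersetCard.1 S.2).2).symm j : k)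
  -- Surplus generic points go to the zero vector; the conditions there are never used.
  let c : Fin n → Fin (N + 1) → k := Function.extend e pt 0
  have hc : ∀ q : Fin N → k, Function.Injective q → (∀ j, q j ∈ A) → ∃ i, c i = starPoint q := by
    intro q hq hqA
    have hS : Finset.univ.map ⟨q, hq⟩ ∈ A.powersetCard N := by
      rw [Finset.mem_powersetCard]
      refine ⟨fun a ha => ?_, by simp⟩
      obtain ⟨j, _, rfl⟩ := Finset.mem_map.1 ha
      exact hqA j
    refine ⟨e ⟨_, hS⟩, ?_⟩
    simp only [c, e.injective.extend_apply, pt]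
    refine starPoint_eq_of_range_eq (Subtype.val_injective.comp (Equiv.injective _)) hq ?_
    rw [Set.range_comp' Subtype.val, Equiv.range_eq_univ]
    simp [Set.range]
  obtain ⟨g, hg0, hgdeg, hg⟩ := exists_specialization c hf0
  have hinj := (algebraMap k (GenericField k n N)).injective
  have : Infinite (GenericField k n N) := Infinite.of_injective _ hinj
  have key := mul_card_le_of_le_vanishingOrder_starPoint (N := N) (m := m)
    (A.map ⟨algebraMap k (GenericField k n N), hinj⟩) (by simp [hA]) hg0 ?_
  · rw [Finset.card_map, hA] at key
    exact key.trans (Nat.mul_le_mul_right N hgdeg)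
  · intro q' hq' hq'A
    have h1 : ∀ j, ∃ a ∈ A, algebraMap k (GenericField k n N) a = q' j := fun j => by
      simpa using hq'A j
    choose q hqA hq using h1
    have hqinj : Function.Injective q := fun i j hij => hq' (by rw [← hq, ← hq, hij])
    obtain ⟨i, hi⟩ := hc q hqinj hqA
    have h2 : ∀ j, starPoint q' j = algebraMap k (GenericField k n N) (c i j) := by
      intro j
      rw [hi]
      refine Fin.cases ?_ (fun j => ?_) j
      · simp [starPoint]
      · simp only [starPoint, Fin.cons_succ]
        rw [map_eval, map_esymm]
        congr 2
        exact (funext hq).symm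
    simp only [h2]
    exact hg i m (le_vanishingOrder_of_mem_symbolicPower (genericCoords k n N)
      (genericCoords_ne_zero k n N)
      (fun i j hij => not_pointIdeal_genericProjPoint_le k hN i j hij) hf i)

theorem pow_le_symbolicPower {R : Type*} [CommRing R] (I : Ideal R) (m : ℕ) :
    I ^ m ≤ symbolicPower I m :=
  le_iInf fun _ => Ideal.le_comap_map

theorem theorem2p5 (k : Type*) [Field k] [IsAlgClosed k] [CharZero k] (n N : ℕ)
    (hn : 1 ≤ n) (hN : 1 ≤ N) (m : ℕ) (hm : 1 ≤ m) :
    ((initialDegree (genericPointsIdeal k n N) : ℝ) + (N : ℝ) - 1) / (N : ℝ) ≤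
      (initialDegree (symbolicPower (genericPointsIdeal k n N) m) : ℝ) / (m : ℝ) := by
  classical
  have hex : ∃ d, n < (d + N).choose N := ⟨n, lt_choose_add hN n⟩
  obtain ⟨d, hd⟩ : ∃ d, Nat.find hex = d + 1 := by
    refine Nat.exists_eq_succ_of_ne_zero fun h => ?_
    have := Nat.find_spec hex
    rw [h, zero_add, Nat.choose_self] at this
    omega
  have hd1 : n < (d + 1 + N).choose N := hd ▸ Nat.find_spec hex
  have hd2 : (d + N).choose N ≤ n := not_lt.1 (Nat.find_min hex (m := d) (by omega))
  obtain ⟨f, hfH, hf0, hfd⟩ := exists_isHomogeneous_mem_iInf_pointIdeal (genericCoords k n N)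
    (genericCoords_ne_zero k n N) (d + 1) (by simpa using hd1)
  have h1 : initialDegree (genericPointsIdeal k n N) ≤ d + 1 := Nat.sInf_le ⟨f, hfH, hf0, hfd⟩
  -- The infimum is attained because `f ^ m` makes the set nonempty, which excludes the default
  -- value `0`.
  obtain ⟨g, hg, hg0, hgd⟩ : initialDegree (symbolicPower (genericPointsIdeal k n N) m) ∈
      {e : ℕ | ∃ g ∈ symbolicPower (genericPointsIdeal k n N) m, g ≠ 0 ∧ g.totalDegree = e} :=
    Nat.sInf_mem ⟨_, f ^ m, pow_le_symbolicPower _ _ (Ideal.pow_mem_pow hfH m),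
      pow_ne_zero m hf0, rfl⟩
  have h2 := mul_le_totalDegree_mul hN hd2 hg0 hg
  rw [hgd] at h2
  have h2' : (m : ℝ) * (d + N) ≤
      (initialDegree (symbolicPower (genericPointsIdeal k n N) m) : ℝ) * N := by
    exact_mod_cast h2
  have h1' : (initialDegree (genericPointsIdeal k n N) : ℝ) ≤ d + 1 := by exact_mod_cast h1
  have hm' : (0 : ℝ) < m := by exact_mod_cast hm
  have hN' : (0 : ℝ) < N := by exact_mod_cast hN
  rw [div_le_div_iff₀ hN' hm']
  refine le_trans ?_ h2'
  rw [mul_comm]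
  exact mul_le_mul_of_nonneg_left (by linarith) hm'.le

end Main
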